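/- Let $\mathbb{F}$ be a field and let $q\in\mathbb{F}$ be nonzero and not a root of unity. Let $\mathcal{H}(q)$ be the $q$-deformed Heisenberg algebra, i.e. the unital associative $\mathbb{F}$-algebra with generators $A,B$ and relation $AB-qBA=1$, regarded as a Lie algebra under $[f,g]=fg-gf$, and let $\mathcal{L}(q)$ be the Lie subalgebra of $\mathcal{H}(q)$ generated by $A,B$. Then $\mathcal{L}(q)$ is a Lie ideal of $\mathcal{H}(q)$. The quotient Lie algebra $\mathcal{H}(q)/\mathcal{L}(q)$ is infinite-dimensional; the images of $1$, $A^n$ $(n\geq 2)$ and $B^m$ $(m\geq 2)$ are pairwise distinct and form a basis of it. Moreover the quotient is abelian, and it is one-step nilpotent: for the lower central series $L^{(0)}=L$, $L^{(p)}=[L^{(p-1)},L]$ of $L=\mathcal{H}(q)/\mathcal{L}(q)$, the smallest $p$ with $L^{(p)}=0$ is $p=1$. -/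

import Mathlib

namespace QHeisenberg

/-- The defining relation `AB - qBA = 1` on the free unital associative algebra on two letters;
the letter `0` stands for `A` and the letter `1` for `B`. -/
inductive Rel {F : Type*} [Field F] (q : F) :
    FreeAlgebra F (Fin 2) → FreeAlgebra F (Fin 2) → Prop
  | comm : Rel q
      (FreeAlgebra.ι F 0 * FreeAlgebra.ι F 1 - q • (FreeAlgebra.ι F 1 * FreeAlgebra.ι F 0)) 1

/-- The `q`-deformed Heisenberg algebra: the unital associative `F`-algebra with generators
`A, B` and relation `AB - qBA = 1`. -/
abbrev Alg {F : Type*} [Field F] (q : F) : Type _ := RingQuot (Rel q)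

/-- The generator `A`. -/
noncomputable def genA {F : Type*} [Field F] (q : F) : Alg q :=
  RingQuot.mkAlgHom F (Rel q) (FreeAlgebra.ι F 0)

/-- The generator `B`. -/
noncomputable def genB {F : Type*} [Field F] (q : F) : Alg q :=
  RingQuot.mkAlgHom F (Rel q) (FreeAlgebra.ι F 1)

/-- The algebra is a Lie algebra under the commutator bracket `⁅f, g⁆ = f * g - g * f`. -/
noncomputable instance instLieRing {F : Type*} [Field F] (q : F) : LieRing (Alg q) :=
  LieRing.ofAssociativeRing

noncomputable instance instLieAlgebra {F : Type*} [Field F] (q : F) : LieAlgebra F (Alg q) :=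
  LieAlgebra.ofAssociativeAlgebra

/-- The Lie subalgebra generated by `A` and `B`, that is, the set of all Lie polynomials
in `A` and `B`. -/
noncomputable def liePoly {F : Type*} [Field F] (q : F) : LieSubalgebra F (Alg q) :=
  LieSubalgebra.lieSpan F (Alg q) {genA q, genB q}

/-- A Lie algebra `L` is `p`-step nilpotent if `p` is the smallest natural number such that the
`p`-th term of the lower central series `L⁽⁰⁾ = L`, `L⁽ᵖ⁺¹⁾ = [L⁽ᵖ⁾, L]` is zero. -/
def IsStepNilpotent (F L : Type*) [Field F] [LieRing L] [LieAlgebra F L] (p : ℕ) : Prop :=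
  IsLeast {k : ℕ | LieModule.lowerCentralSeries F L L k = ⊥} p

end QHeisenberg

namespace QHeisenberg

/-! ### Commutation rules in an arbitrary algebra with `a * b = 1 + q • (b * a)`. -/

section Commutation

variable {F R : Type*} [Field F] [Ring R] [Algebra F R] {q : F} {a b : R}

/-! Put `C = AB - BA`. Then `AC = qCA` and `CB = qBC`, so the monomials `C ^ k * A ^ l` and `B ^ l *
C ^ k` span the algebra. Since `q` is not a root of unity, brackets with `A` and `B` put every
monomial with `k > 0` in `liePoly q` (`commutator_pow_mem_of_closed`); only `1` and the powers of
`A` and `B` from the second on remain to span the quotient. For independence, map to the commutative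
Laurent polynomials, `A` to `T` and `B` to a multiple of `T⁻¹`. Commutators die, so forgetting the
exponents `±1` gives a linear map that kills `liePoly q` and separates the remaining monomials.
Hence `liePoly q` is its kernel (`mem_liePoly_iff`). It thus contains every commutator, which makes
it an ideal with abelian quotient. -/

theorem mul_commutator_pow (h : a * b = 1 + q • (b * a)) (k : ℕ) :
    a * (a * b - b * a) ^ k = q ^ k • ((a * b - b * a) ^ k * a) := by
  have h1 : a * (a * b - b * a) = q • ((a * b - b * a) * a) := by
    have : a * (a * b - b * a) = a * (a * b) - (a * b) * a := by noncomm_ring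
    rw [this, sub_mul, h]
    simp only [mul_add, add_mul, mul_smul_comm, smul_mul_assoc, smul_sub, smul_add, mul_one,
      one_mul, ← mul_assoc]
    rw [h]
    simp only [add_mul, smul_mul_assoc, smul_add, one_mul]
    abel
  induction k with
  | zero => simp
  | succ k ih =>
    rw [pow_succ, ← mul_assoc, ih, smul_mul_assoc, mul_assoc, h1, mul_smul_comm, smul_smul,
      ← pow_succ, mul_assoc]

theorem commutator_pow_mul (h : a * b = 1 + q • (b * a)) (k : ℕ) :
    (a * b - b * a) ^ k * b = q ^ k • (b * (a * b - b * a) ^ k) := by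
  have h1 : (a * b - b * a) * b = q • (b * (a * b - b * a)) := by
    have : (a * b - b * a) * b = (a * b) * b - b * (a * b) := by noncomm_ring
    rw [this, mul_sub, h]
    simp only [mul_add, add_mul, mul_smul_comm, smul_mul_assoc, smul_sub, smul_add, mul_one,
      one_mul, mul_assoc]
    rw [h]
    simp only [mul_add, mul_smul_comm, smul_add, mul_one]
    abel
  induction k with
  | zero => simp
  | succ k ih =>
    rw [pow_succ', mul_assoc, ih, mul_smul_comm, ← mul_assoc, h1, smul_mul_assoc, smul_smul,
      ← pow_succ, mul_assoc]

theorem commutator_mul_pow (h : a * b = 1 + q • (b * a)) (l : ℕ) :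
    (a * b - b * a) * b ^ l = q ^ l • (b ^ l * (a * b - b * a)) := by
  have h1 := commutator_pow_mul h 1
  simp only [pow_one] at h1
  induction l with
  | zero => simp
  | succ l ih =>
    rw [pow_succ, ← mul_assoc, ih, smul_mul_assoc, mul_assoc, h1, mul_smul_comm, smul_smul,
      ← pow_succ, mul_assoc]

theorem smul_mul_eq_commutator_sub_one (h : a * b = 1 + q • (b * a)) :
    (q - 1) • (b * a) = (a * b - b * a) - 1 := by
  rw [h, sub_smul, one_smul]; abel

theorem smul_mul_eq_smul_commutator_sub_one (h : a * b = 1 + q • (b * a)) :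
    (q - 1) • (a * b) = q • (a * b - b * a) - 1 := by
  have : (1 : R) = a * b - q • (b * a) := by rw [h]; abel
  rw [this, sub_smul, one_smul, smul_sub]; abel

/-- The span of the monomials `C ^ k * a ^ l` and `b ^ l * C ^ k`, where `C = a * b - b * a`. -/
def monomialSpan (F : Type*) {R : Type*} [Field F] [Ring R] [Algebra F R] (a b : R) :
    Submodule F R :=
  Submodule.span F (Set.range (fun p : ℕ × ℕ => (a * b - b * a) ^ p.1 * a ^ p.2) ∪
    Set.range (fun p : ℕ × ℕ => b ^ p.2 * (a * b - b * a) ^ p.1))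

theorem commutator_pow_mul_pow_mem (k l : ℕ) :
    (a * b - b * a) ^ k * a ^ l ∈ monomialSpan F a b :=
  Submodule.subset_span (Or.inl ⟨(k, l), rfl⟩)

theorem pow_mul_commutator_pow_mem (k l : ℕ) :
    b ^ l * (a * b - b * a) ^ k ∈ monomialSpan F a b :=
  Submodule.subset_span (Or.inr ⟨(k, l), rfl⟩)

theorem monomialSpan_le {P : Submodule F R}
    (h1 : ∀ k l : ℕ, (a * b - b * a) ^ k * a ^ l ∈ P)
    (h2 : ∀ k l : ℕ, b ^ l * (a * b - b * a) ^ k ∈ P) : monomialSpan F a b ≤ P := by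
  refine Submodule.span_le.2 (Set.union_subset ?_ ?_)
  · rintro _ ⟨p, rfl⟩; exact h1 _ _
  · rintro _ ⟨p, rfl⟩; exact h2 _ _

theorem generator_left_mul_mem_monomialSpan (h : a * b = 1 + q • (b * a)) (hq1 : q - 1 ≠ 0) {x : R}
    (hx : x ∈ monomialSpan F a b) : a * x ∈ monomialSpan F a b := by
  refine monomialSpan_le (P := (monomialSpan F a b).comap (LinearMap.mulLeft F a)) ?_ ?_ hx
  · intro k l
    simp only [Submodule.mem_comap, LinearMap.mulLeft_apply]
    rw [← mul_assoc, mul_commutator_pow h, smul_mul_assoc, mul_assoc, ← pow_succ']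
    exact Submodule.smul_mem _ _ (commutator_pow_mul_pow_mem _ _)
  · rintro k (_ | l)
    · simp only [Submodule.mem_comap, LinearMap.mulLeft_apply, pow_zero, one_mul]
      rw [mul_commutator_pow h]
      have := commutator_pow_mul_pow_mem (F := F) (a := a) (b := b) k 1
      rw [pow_one] at this
      exact Submodule.smul_mem _ _ this
    · simp only [Submodule.mem_comap, LinearMap.mulLeft_apply]
      -- Scaling by `q - 1` turns the inner `a * b` into `q • C - 1`.
      rw [← Submodule.smul_mem_iff _ hq1, pow_succ', mul_assoc, ← mul_assoc a, ← smul_mul_assoc,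
        smul_mul_eq_smul_commutator_sub_one h, sub_mul, one_mul, smul_mul_assoc, ← mul_assoc,
        commutator_mul_pow h, smul_mul_assoc, mul_assoc, ← pow_succ']
      exact Submodule.sub_mem _ (Submodule.smul_mem _ _ (Submodule.smul_mem _ _
        (pow_mul_commutator_pow_mem _ _))) (pow_mul_commutator_pow_mem _ _)

theorem generator_right_mul_mem_monomialSpan (h : a * b = 1 + q • (b * a)) (hq0 : q ≠ 0)
    (hq1 : q - 1 ≠ 0) {x : R}
    (hx : x ∈ monomialSpan F a b) : b * x ∈ monomialSpan F a b := by
  refine monomialSpan_le (P := (monomialSpan F a b).comap (LinearMap.mulLeft F b)) ?_ ?_ hx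
  · rintro k (_ | l)
    · simp only [Submodule.mem_comap, LinearMap.mulLeft_apply, pow_zero, mul_one]
      simpa using pow_mul_commutator_pow_mem (F := F) (a := a) (b := b) k 1
    · simp only [Submodule.mem_comap, LinearMap.mulLeft_apply]
      -- The factor `q ^ k` lets `b` pass to the right of `C ^ k`; then `(q - 1) • (b * a) = C - 1`.
      rw [← Submodule.smul_mem_iff _ (pow_ne_zero k hq0), ← Submodule.smul_mem_iff _ hq1,
        ← mul_assoc, ← smul_mul_assoc, ← commutator_pow_mul h, pow_succ', mul_assoc,
        ← mul_assoc b, ← mul_smul_comm, ← smul_mul_assoc, smul_mul_eq_commutator_sub_one h,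
        sub_mul, one_mul, mul_sub, ← mul_assoc, ← pow_succ]
      exact Submodule.sub_mem _ (commutator_pow_mul_pow_mem _ _) (commutator_pow_mul_pow_mem _ _)
  · intro k l
    simp only [Submodule.mem_comap, LinearMap.mulLeft_apply]
    rw [← mul_assoc, ← pow_succ']
    exact pow_mul_commutator_pow_mem _ _

variable {L : Submodule F R}

/-- Bracketing `a` with `C ^ k * a ^ l` gives `(q ^ k - 1) • (C ^ k * a ^ (l + 1))`, and the scalar
is invertible because `k > 0`. -/
theorem commutator_pow_mul_pow_mem_of_closed (h : a * b = 1 + q • (b * a))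
    (hq : ∀ n : ℕ, 0 < n → q ^ n ≠ 1) (hL : ∀ x ∈ L, ∀ y ∈ L, x * y - y * x ∈ L)
    (ha : a ∈ L) {k : ℕ} (hk : 0 < k) (hC : (a * b - b * a) ^ k ∈ L) (l : ℕ) :
    (a * b - b * a) ^ k * a ^ l ∈ L := by
  induction l with
  | zero => simpa using hC
  | succ l ih =>
    have h1 := hL a ha _ ih
    rw [← mul_assoc, mul_commutator_pow h, smul_mul_assoc, mul_assoc, mul_assoc, ← pow_succ',
      ← pow_succ, ← one_smul F (_ * a ^ (l + 1)), smul_smul, ← sub_smul, mul_one] at h1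
    exact (Submodule.smul_mem_iff _ (sub_ne_zero.2 (hq k hk))).1 h1

theorem pow_mul_commutator_pow_mem_of_closed (h : a * b = 1 + q • (b * a))
    (hq : ∀ n : ℕ, 0 < n → q ^ n ≠ 1) (hL : ∀ x ∈ L, ∀ y ∈ L, x * y - y * x ∈ L)
    (hb : b ∈ L) {k : ℕ} (hk : 0 < k) (hC : (a * b - b * a) ^ k ∈ L) (l : ℕ) :
    b ^ l * (a * b - b * a) ^ k ∈ L := by
  induction l with
  | zero => simpa using hC
  | succ l ih =>
    have h1 := hL _ ih b hb
    rw [mul_assoc, commutator_pow_mul h, mul_smul_comm, ← mul_assoc, ← mul_assoc, ← pow_succ',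
      ← pow_succ, ← one_smul F (b ^ (l + 1) * _), smul_smul, ← sub_smul, mul_one] at h1
    exact (Submodule.smul_mem_iff _ (sub_ne_zero.2 (hq k hk))).1 h1

/-- The bracket of `a` with `b * C ^ (k + 1)` is, up to a scalar, a combination of `C ^ (k + 2)` and
`C ^ (k + 1)` in which the former has the nonzero coefficient `q ^ (k + 2) - 1`. -/
theorem commutator_pow_mem_of_closed (h : a * b = 1 + q • (b * a))
    (hq : ∀ n : ℕ, 0 < n → q ^ n ≠ 1) (hL : ∀ x ∈ L, ∀ y ∈ L, x * y - y * x ∈ L)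
    (ha : a ∈ L) (hb : b ∈ L) (k : ℕ) : (a * b - b * a) ^ (k + 1) ∈ L := by
  have hq1 : q - 1 ≠ 0 := sub_ne_zero.2 (by simpa using hq 1 one_pos)
  induction k with
  | zero => simpa using hL a ha b hb
  | succ k ih =>
    have h1 : b * (a * b - b * a) ^ (k + 1) ∈ L := by
      simpa using pow_mul_commutator_pow_mem_of_closed h hq hL hb k.succ_pos ih 1
    have h2 := hL a ha _ h1
    have h3 : ((q - 1) * q ^ (k + 1)) • (a * (b * (a * b - b * a) ^ (k + 1)) -
          b * (a * b - b * a) ^ (k + 1) * a) =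
        (q ^ (k + 2) - 1) • (a * b - b * a) ^ (k + 2) -
          (q ^ (k + 1) - 1) • (a * b - b * a) ^ (k + 1) := by
      have e1 : (q - 1) • (a * (b * (a * b - b * a) ^ (k + 1))) =
          q • (a * b - b * a) ^ (k + 2) - (a * b - b * a) ^ (k + 1) := by
        rw [← mul_assoc, ← smul_mul_assoc, smul_mul_eq_smul_commutator_sub_one h, sub_mul,
          one_mul, smul_mul_assoc, ← pow_succ']
      have e2 : ((q - 1) * q ^ (k + 1)) • (b * (a * b - b * a) ^ (k + 1) * a) =
          (a * b - b * a) ^ (k + 2) - (a * b - b * a) ^ (k + 1) := by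
        rw [mul_smul, ← smul_mul_assoc, ← commutator_pow_mul h, mul_assoc, ← mul_smul_comm,
          smul_mul_eq_commutator_sub_one h, mul_sub, mul_one, ← pow_succ]
      rw [smul_sub, e2, mul_comm, mul_smul, e1]
      module
    have h4 := L.add_mem (L.smul_mem ((q - 1) * q ^ (k + 1)) h2)
      (L.smul_mem (q ^ (k + 1) - 1) ih)
    rw [h3, sub_add_cancel] at h4
    exact (Submodule.smul_mem_iff _ (sub_ne_zero.2 (hq _ (by omega)))).1 h4

end Commutation

/-! ### The presented algebra and its monomial spanning set. -/

section Presentation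

variable {F : Type*} [Field F] {q : F}

theorem genA_mul_genB : genA q * genB q = 1 + q • (genB q * genA q) := by
  have h := RingQuot.mkAlgHom_rel F (Rel.comm (q := q))
  simp only [map_sub, map_mul, map_smul, map_one] at h
  exact sub_eq_iff_eq_add.1 h

theorem lie_eq_commutator (x y : Alg q) : ⁅x, y⁆ = x * y - y * x := rfl

theorem eq_top_of_gen_mul_mem {P : Submodule F (Alg q)} (h1 : 1 ∈ P)
    (hA : ∀ x ∈ P, genA q * x ∈ P) (hB : ∀ x ∈ P, genB q * x ∈ P) : P = ⊤ := by
  rw [Submodule.eq_top_iff']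
  intro x
  obtain ⟨x, rfl⟩ := RingQuot.mkAlgHom_surjective F (Rel q) x
  -- Quantifying over `y` lets the induction pass through products.
  suffices H : ∀ y ∈ P, RingQuot.mkAlgHom F (Rel q) x * y ∈ P by simpa using H 1 h1
  induction x using FreeAlgebra.induction with
  | grade0 r =>
    intro y hy
    rw [AlgHom.commutes, ← Algebra.smul_def]
    exact P.smul_mem r hy
  | grade1 i =>
    fin_cases i
    · exact hA
    · exact hB
  | mul x z hx hz =>
    intro y hy
    rw [map_mul, mul_assoc]
    exact hx _ (hz y hy)
  | add x z hx hz =>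
    intro y hy
    rw [map_add, add_mul]
    exact P.add_mem (hx y hy) (hz y hy)

theorem monomialSpan_eq_top (hq0 : q ≠ 0) (hq1 : q - 1 ≠ 0) :
    monomialSpan F (genA q) (genB q) = ⊤ := by
  refine eq_top_of_gen_mul_mem ?_ (fun x => generator_left_mul_mem_monomialSpan genA_mul_genB hq1)
    (fun x => generator_right_mul_mem_monomialSpan genA_mul_genB hq0 hq1)
  simpa using commutator_pow_mul_pow_mem (F := F) (a := genA q) (b := genB q) 0 0

/-! ### The Laurent polynomial representation and linear independence. -/

open LaurentPolynomial in
/-- The algebra homomorphism to the Laurent polynomials given by `A ↦ T` and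
`B ↦ (1 - q)⁻¹ T⁻¹`. -/
noncomputable def toLaurent (hq1 : 1 - q ≠ 0) : Alg q →ₐ[F] LaurentPolynomial F :=
  RingQuot.liftAlgHom F ⟨FreeAlgebra.lift F ![T 1, (1 - q)⁻¹ • T (-1)], by
    rintro _ _ ⟨⟩
    simp only [map_sub, map_mul, map_smul, map_one, FreeAlgebra.lift_ι_apply, Matrix.cons_val_zero,
      Matrix.cons_val_one, mul_smul_comm, smul_mul_assoc, ← T_add]
    rw [smul_smul, neg_add_cancel, add_neg_cancel, ← sub_smul, ← one_sub_mul, mul_inv_cancel₀ hq1, one_smul]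
    rfl⟩

open LaurentPolynomial in
theorem toLaurent_genA_pow (hq1 : 1 - q ≠ 0) (n : ℕ) :
    toLaurent hq1 (genA q ^ n) = T n := by
  rw [map_pow, toLaurent, genA, RingQuot.liftAlgHom_mkAlgHom_apply]
  simp

open LaurentPolynomial in
theorem toLaurent_genB_pow (hq1 : 1 - q ≠ 0) (n : ℕ) :
    toLaurent hq1 (genB q ^ n) = ((1 - q)⁻¹) ^ n • T (-n : ℤ) := by
  rw [map_pow, toLaurent, genB, RingQuot.liftAlgHom_mkAlgHom_apply]
  simp [smul_pow]

/-- The exponents in the Laurent polynomial ring of the elements `1`, `A ^ (n + 2)`,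
`B ^ (m + 2)`. -/
def exponent : Unit ⊕ (ℕ ⊕ ℕ) → ℤ
  | Sum.inl _ => 0
  | Sum.inr (Sum.inl n) => (n + 2 : ℕ)
  | Sum.inr (Sum.inr m) => -(m + 2 : ℕ)

theorem exponent_injective : Function.Injective exponent := by
  rintro (_ | n | n) (_ | m | m) h <;> simp only [exponent] at h <;>
    first
    | rfl
    | (exfalso; omega)
    | (obtain rfl : n = m := by omega
       rfl)

theorem exponent_ne_one (i : Unit ⊕ (ℕ ⊕ ℕ)) : exponent i ≠ 1 := by
  rcases i with _ | n | n <;> simp only [exponent] <;> omega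

theorem exponent_ne_neg_one (i : Unit ⊕ (ℕ ⊕ ℕ)) : exponent i ≠ -1 := by
  rcases i with _ | n | n <;> simp only [exponent] <;> omega

/-- The family consisting of `1`, `A ^ (n + 2)` and `B ^ (m + 2)`. -/
noncomputable def complementFamily (q : F) : Unit ⊕ (ℕ ⊕ ℕ) → Alg q
  | Sum.inl _ => 1
  | Sum.inr (Sum.inl n) => genA q ^ (n + 2)
  | Sum.inr (Sum.inr m) => genB q ^ (m + 2)

/-- The coefficients of the image in the Laurent polynomials at the exponents other than
`1` and `-1`. -/
noncomputable def coeffMap (hq1 : 1 - q ≠ 0) : Alg q →ₗ[F] (Unit ⊕ (ℕ ⊕ ℕ)) →₀ F :=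
  Finsupp.lcomapDomain exponent exponent_injective ∘ₗ
    (AddMonoidAlgebra.coeffLinearEquiv F).toLinearMap ∘ₗ (toLaurent hq1).toLinearMap

theorem coeffMap_apply (hq1 : 1 - q ≠ 0) (x : Alg q) (i : Unit ⊕ (ℕ ⊕ ℕ)) :
    coeffMap hq1 x i = (toLaurent hq1 x).coeff (exponent i) := rfl

theorem coeffMap_lie (hq1 : 1 - q ≠ 0) (x y : Alg q) : coeffMap hq1 ⁅x, y⁆ = 0 := by
  ext i
  rw [coeffMap_apply, lie_eq_commutator, map_sub, map_mul, map_mul, mul_comm, sub_self]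
  rfl

theorem coeffMap_eq_zero_of_mem_liePoly (hq1 : 1 - q ≠ 0) {x : Alg q} (hx : x ∈ liePoly q) :
    coeffMap hq1 x = 0 := by
  let K : LieSubalgebra F (Alg q) :=
    { LinearMap.ker (coeffMap hq1) with lie_mem' := fun _ _ => coeffMap_lie hq1 _ _ }
  have hK : liePoly q ≤ K := by
    refine LieSubalgebra.lieSpan_le.2 ?_
    rintro _ (rfl | rfl)
    · change coeffMap hq1 _ = 0
      ext i
      rw [coeffMap_apply, ← pow_one (genA q), toLaurent_genA_pow]
      simp [(exponent_ne_one i).symm]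
    · change coeffMap hq1 _ = 0
      ext i
      rw [coeffMap_apply, ← pow_one (genB q), toLaurent_genB_pow]
      simp [(exponent_ne_neg_one i).symm]
  exact hK hx

theorem coeffMap_complementFamily (hq1 : 1 - q ≠ 0) :
    ∃ c : Unit ⊕ (ℕ ⊕ ℕ) → Fˣ, ∀ i,
      coeffMap hq1 (complementFamily q i) = c i • Finsupp.single i 1 := by
  -- Only powers of `B` pick up a scalar, from `B ↦ (1 - q)⁻¹ T⁻¹`.
  refine ⟨Sum.elim 1 (Sum.elim 1 fun m => (Units.mk0 _ hq1)⁻¹ ^ (m + 2)), fun i => ?_⟩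
  have key : ∀ (x : Alg q) (c : F), toLaurent hq1 x = c • LaurentPolynomial.T (exponent i) →
      coeffMap hq1 x = c • Finsupp.single i 1 := by
    intro x c hx
    ext j
    rw [coeffMap_apply, hx]
    simp [Finsupp.single_apply, exponent_injective.eq_iff]
  rw [Units.smul_def]
  refine key _ _ ?_
  rcases i with _ | n | m
  · simp [complementFamily, exponent]
  · simp only [complementFamily, exponent, toLaurent_genA_pow]; simp
  · simp only [complementFamily, exponent, toLaurent_genB_pow]; simp

theorem liePoly_sup_span_eq_top (hq0 : q ≠ 0) (hq : ∀ n : ℕ, 0 < n → q ^ n ≠ 1) :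
    (liePoly q).toSubmodule ⊔ Submodule.span F (Set.range (complementFamily q)) = ⊤ := by
  have hq1 : q - 1 ≠ 0 := sub_ne_zero.2 (by simpa using hq 1 one_pos)
  have hL : ∀ x ∈ (liePoly q).toSubmodule, ∀ y ∈ (liePoly q).toSubmodule,
      x * y - y * x ∈ (liePoly q).toSubmodule := fun x hx y hy => (liePoly q).lie_mem hx hy
  have hA : genA q ∈ (liePoly q).toSubmodule := LieSubalgebra.subset_lieSpan (by simp)
  have hB : genB q ∈ (liePoly q).toSubmodule := LieSubalgebra.subset_lieSpan (by simp)
  have hC := commutator_pow_mem_of_closed genA_mul_genB hq hL hA hB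
  have hv : ∀ i, complementFamily q i ∈
      (liePoly q).toSubmodule ⊔ Submodule.span F (Set.range (complementFamily q)) :=
    fun i => Submodule.mem_sup_right (Submodule.subset_span ⟨i, rfl⟩)
  rw [eq_top_iff, ← monomialSpan_eq_top hq0 hq1]
  refine monomialSpan_le ?_ ?_
  · rintro (_ | k) l
    · rw [pow_zero, one_mul]
      rcases l with _ | _ | l
      · simpa [complementFamily] using hv (Sum.inl ())
      · simpa using Submodule.mem_sup_left hA
      · exact hv (Sum.inr (Sum.inl l))
    · exact Submodule.mem_sup_left
        (commutator_pow_mul_pow_mem_of_closed genA_mul_genB hq hL hA k.succ_pos (hC k) l)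
  · rintro (_ | k) l
    · rw [pow_zero, mul_one]
      rcases l with _ | _ | l
      · simpa [complementFamily] using hv (Sum.inl ())
      · simpa using Submodule.mem_sup_left hB
      · exact hv (Sum.inr (Sum.inr l))
    · exact Submodule.mem_sup_left
        (pow_mul_commutator_pow_mem_of_closed genA_mul_genB hq hL hB k.succ_pos (hC k) l)

theorem linearIndependent_coeffMap_complementFamily (hq1 : 1 - q ≠ 0) :
    LinearIndependent F (coeffMap hq1 ∘ complementFamily q) := by
  obtain ⟨c, hc⟩ := coeffMap_complementFamily hq1
  have h : coeffMap hq1 ∘ complementFamily q =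
      c • fun i => (Finsupp.single i 1 : (Unit ⊕ (ℕ ⊕ ℕ)) →₀ F) := funext hc
  rw [h]
  exact (Finsupp.linearIndependent_single_one F _).units_smul c

theorem mem_liePoly_iff (hq0 : q ≠ 0) (hq : ∀ n : ℕ, 0 < n → q ^ n ≠ 1) (hq1 : 1 - q ≠ 0)
    {x : Alg q} : x ∈ liePoly q ↔ coeffMap hq1 x = 0 := by
  refine ⟨coeffMap_eq_zero_of_mem_liePoly hq1, fun hx => ?_⟩
  obtain ⟨l, hl, y, hy, rfl⟩ := Submodule.mem_sup.1
    ((liePoly_sup_span_eq_top hq0 hq).symm ▸ Submodule.mem_top : x ∈ _)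
  obtain ⟨f, rfl⟩ := (Finsupp.mem_span_range_iff_exists_finsupp).1 hy
  rw [map_add, coeffMap_eq_zero_of_mem_liePoly hq1 hl, zero_add] at hx
  have hf : f = 0 := by
    refine linearIndependent_iff.1 (linearIndependent_coeffMap_complementFamily hq1) f ?_
    rw [← hx, Finsupp.linearCombination_apply, map_finsuppSum]
    simp
  rw [hf]
  simpa using hl

end Presentation

end QHeisenberg

open QHeisenberg in
theorem mainTheorem1 {F : Type*} [Field F] (q : F) (hq0 : q ≠ 0)
    (hq : ∀ n : ℕ, 0 < n → q ^ n ≠ 1) :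
    ∃ J : LieIdeal F (QHeisenberg.Alg q),
      J.toLieSubalgebra = QHeisenberg.liePoly q ∧
      ¬ FiniteDimensional F (QHeisenberg.Alg q ⧸ J) ∧
      (∃ b : Module.Basis (Unit ⊕ (ℕ ⊕ ℕ)) F (QHeisenberg.Alg q ⧸ J),
        b (Sum.inl ()) = LieSubmodule.Quotient.mk (1 : QHeisenberg.Alg q) ∧
        (∀ n : ℕ, b (Sum.inr (Sum.inl n)) =
          LieSubmodule.Quotient.mk (QHeisenberg.genA q ^ (n + 2))) ∧
        (∀ m : ℕ, b (Sum.inr (Sum.inr m)) =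
          LieSubmodule.Quotient.mk (QHeisenberg.genB q ^ (m + 2)))) ∧
      IsLieAbelian (QHeisenberg.Alg q ⧸ J) ∧
      QHeisenberg.IsStepNilpotent F (QHeisenberg.Alg q ⧸ J) 1 := by
  have hq1 : 1 - q ≠ 0 := sub_ne_zero.2 (by simpa using (hq 1 one_pos).symm)
  have hmem : ∀ {x : Alg q}, x ∈ liePoly q ↔ coeffMap hq1 x = 0 := mem_liePoly_iff hq0 hq hq1
  let J : LieIdeal F (Alg q) :=
    { (liePoly q).toSubmodule with lie_mem := fun _ => hmem.2 (coeffMap_lie hq1 _ _) }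
  have hJ : ∀ {x : Alg q}, x ∈ J ↔ coeffMap hq1 x = 0 := hmem
  let π : Alg q →ₗ[F] Alg q ⧸ J := J.toSubmodule.mkQ
  have hπ : Function.Surjective π := Submodule.mkQ_surjective _
  let κ : (Alg q ⧸ J) →ₗ[F] (Unit ⊕ (ℕ ⊕ ℕ)) →₀ F :=
    J.toSubmodule.liftQ (coeffMap hq1) fun _ => hJ.1
  have hli : LinearIndependent F (π ∘ complementFamily q) :=
    LinearIndependent.of_comp κ (linearIndependent_coeffMap_complementFamily hq1)
  have hspan : ⊤ ≤ Submodule.span F (Set.range (π ∘ complementFamily q)) := by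
    rintro x -
    obtain ⟨x, rfl⟩ := hπ x
    obtain ⟨l, hl, y, hy, rfl⟩ := Submodule.mem_sup.1
      ((liePoly_sup_span_eq_top hq0 hq).symm ▸ Submodule.mem_top : x ∈ _)
    have h0 : π l = 0 := (Submodule.Quotient.mk_eq_zero _).2 hl
    rw [map_add, h0, zero_add, Set.range_comp, ← Submodule.map_span]
    exact Submodule.mem_map_of_mem hy
  let b := Module.Basis.mk hli hspan
  have hb : ∀ i, b i = π (complementFamily q i) := fun i => Module.Basis.mk_apply hli hspan i
  have hab : IsLieAbelian (Alg q ⧸ J) := by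
    refine ⟨fun x y => ?_⟩
    obtain ⟨x, rfl⟩ := hπ x
    obtain ⟨y, rfl⟩ := hπ y
    exact (LieSubmodule.Quotient.mk_bracket (I := J) x y).symm.trans
      ((Submodule.Quotient.mk_eq_zero _).2 (hJ.2 (coeffMap_lie hq1 x y)))
  refine ⟨J, rfl, fun hfin => ?_, ⟨b, hb _, fun n => hb _, fun m => hb _⟩, hab, ?_, ?_⟩
  · exact not_finite_iff_infinite.2 inferInstance (Module.Finite.finite_basis b)
  · exact (LieModule.trivial_iff_lower_central_eq_bot F _ _).1 hab
  · intro k hk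
    rcases k with _ | k
    · exfalso
      -- Step `0` is excluded because the class of `1`, a basis vector, is nonzero.
      have h0 : b (Sum.inl ()) ∈ (⊤ : LieSubmodule F (Alg q ⧸ J) (Alg q ⧸ J)) := trivial
      rw [← LieModule.lowerCentralSeries_zero (R := F) (L := Alg q ⧸ J), hk.out] at h0
      exact b.ne_zero _ h0
    · omega
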